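/- Let $\mathcal{B}$ be a bicategory and let $F\colon \mathcal{B}\to\mathbf{Cat}$ be a pseudo-functor. Let $\int dF$ be the bicategory of elements of $F$: - its objects are the pairs $(x,x_-)$ with $x$ an object of $\mathcal{B}$ and $x_-$ an object of $Fx$; - its arrows $(x,x_-)\to(y,y_-)$ are the pairs $(f,f_-)$ with $f\colon x\to y$ an arrow of $\mathcal{B}$ and $f_-\colon Ff(x_-)\to y_-$ an arrow of $Fy$; - its 2-cells $(f,f_-)\Rightarrow(g,g_-)$ are the 2-cells $\alpha\colon f\Rightarrow g$ of $\mathcal{B}$ such that $f_- = g_-\circ (F\alpha)_{x_-}$. Let $P\colon\int dF\to\mathcal{B}$ be the projection. An arrow $u\colon X\to Y$ of $\int dF$ is called co-Cartesian if, for every object $Z$, the comparison functor $g\mapsto (g u,\,Pg,\,P(gu)\cong Pg\circ Pu)$ from $(\int dF)(Y,Z)$ to the pseudo-pullback of $P_{X,Z}\colon(\int dF)(X,Z)\to\mathcal{B}(PX,PZ)$ and $-\circ Pu\colon\mathcal{B}(PY,PZ)\to\mathcal{B}(PX,PZ)$ is an equivalence of categories. For a bicategory $\mathcal{E}$, let $\pi_0\mathcal{E}$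 be the category with the same objects, whose arrows are the arrows of $\mathcal{E}$ modulo the equivalence relation generated by the existence of a 2-cell. Let $\mathcal{W}$ be the family of those arrows of $\pi_0(\int dF)$ that are the class of some co-Cartesian arrow. Then the pseudo-colimit of $F$ is given by the localization $L=\pi_0(\int dF)[\mathcal{W}^{-1}]$ of the category $\pi_0(\int dF)$ at $\mathcal{W}$; that is, there are isomorphisms of categories $$\mathbf{Cat}(L,\mathbf{E})\;\cong\;[\mathcal{B},\mathbf{Cat}](F,\Delta\mathbf{E}),$$ strictly 2-natural in the category $\mathbf{E}$, where $[\mathcal{B},\mathbf{Cat}]$ is the bicategory of pseudo-functors, pseudo-natural transformations and modifications and $\Delta\mathbf{E}$ is the constant pseudo-functor at $\mathbf{E}$. (Here $\mathbf{Cat}$ consists of categories of a size large enough, relative to $\mathcal{B}$ and $F$, to contain $L$.) -/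

import Mathlib

open CategoryTheory Bicategory
open scoped CategoryTheory.Pseudofunctor.StrongTrans

universe w w₁ w₂ v v₁ v₂ u u₁ u₂

namespace BicatColim

/-! ### Connected components of the hom-categories of a bicategory -/

section PiZero

/-- The category `π₀ B` of a bicategory `B`: it has the objects of `B`, and its arrows are the
equivalence classes of arrows of `B` for the relation generated by the existence of a 2-cell
(zigzags of 2-cells). This is the value at `B` of the left adjoint of the inclusion of categories
into bicategories. -/
structure PiZero (B : Type u) where
  /-- The object of `π₀ B` given by an object of `B`. -/
  of ::
  /-- The underlying object of the bicategory. -/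
  as : B

variable (B : Type u) [Bicategory.{w, v} B]

instance : Category (PiZero B) where
  Hom X Y := ConnectedComponents (X.as ⟶ Y.as)
  id X := Quotient.mk _ (𝟙 X.as)
  comp {X Y Z} := Quotient.map₂ (fun f g => f ≫ g) (fun f f' hf g g' hg =>
    (zigzag_obj_of_zigzag (precomp Z.as f) hg).trans
      (zigzag_obj_of_zigzag (postcomp X.as g') hf))
  id_comp := by
    rintro X Y ⟨f⟩
    exact Quotient.sound (Zigzag.of_hom (λ_ f).hom)
  comp_id := by
    rintro X Y ⟨f⟩
    exact Quotient.sound (Zigzag.of_hom (ρ_ f).hom)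
  assoc := by
    rintro X Y Z T ⟨f⟩ ⟨g⟩ ⟨h⟩
    exact Quotient.sound (Zigzag.of_hom (α_ f g h).hom)

variable {B}

/-- The class in `π₀ B` of an arrow of `B`. -/
def PiZero.arrowClass {X Y : B} (f : X ⟶ Y) : PiZero.of X ⟶ PiZero.of Y :=
  Quotient.mk (Zigzag.setoid (X ⟶ Y)) f

/-- For a family `W` of arrows of `B`, the family `[W]` of those arrows of `π₀ B` that are the
class of some arrow of `W`. -/
def PiZero.classes (W : ∀ ⦃X Y : B⦄, (X ⟶ Y) → Prop) : MorphismProperty (PiZero B) :=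
  fun X Y φ => ∃ f : X.as ⟶ Y.as, W f ∧ PiZero.arrowClass f = φ

end PiZero

/-! ### co-Cartesian arrows of a pseudofunctor -/

section CoCartesian

variable {E : Type u₁} [Bicategory.{w₁, v₁} E] {B : Type u₂} [Bicategory.{w₂, v₂} B]

/-- For a pseudofunctor `P : E ⥤ᵖ B` and `f : X ⟶ Y` in `E`, the comparison functor from
`E(Y, Z)` to the pseudo-pullback of `E(X, Z)` and `B(PY, PZ)` over `B(PX, PZ)`, sending `g`
to `(f ≫ g, P g)` with the structural isomorphism `P (f ≫ g) ≅ P f ≫ P g`. -/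
def coCartesianComparison (P : E ⥤ᵖ B) {X Y : E} (f : X ⟶ Y) (Z : E) :
    (Y ⟶ Z) ⥤ Limits.CategoricalPullback (P.mapFunctor X Z) (precomp (P.obj Z) (P.map f)) where
  obj g := ⟨f ≫ g, P.map g, P.mapComp f g⟩
  map {g h} η :=
    { fst := f ◁ η
      snd := P.map₂ η
      w := by
        change P.map₂ (f ◁ η) ≫ (P.mapComp f h).hom = (P.mapComp f g).hom ≫ P.map f ◁ P.map₂ η
        simp }

/-- An arrow `f : X ⟶ Y` of `E` is co-Cartesian for `P : E ⥤ᵖ B` if for every `Z` the square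
with vertices `E(Y, Z)`, `E(X, Z)`, `B(PY, PZ)` and `B(PX, PZ)` is a bipullback of categories. -/
def IsCoCartesian (P : E ⥤ᵖ B) ⦃X Y : E⦄ (f : X ⟶ Y) : Prop :=
  ∀ Z : E, (coCartesianComparison P f Z).IsEquivalence

end CoCartesian

/-! ### The bicategory of elements of a `Cat`-valued pseudofunctor -/

section Elements

variable {B : Type u₁} [Bicategory.{w₁, v₁} B]

/-- Objects of the bicategory of elements (Grothendieck construction) of a `Cat`-valued
pseudofunctor `F`, each category `F b` being regarded as a bicategory with only identity
2-cells. -/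
structure Elements (F : B ⥤ᵖ Cat.{v₂, u₂}) where
  /-- The object of the base. -/
  base : B
  /-- The object of the category over it. -/
  fiber : F.obj base

namespace Elements

variable {F : B ⥤ᵖ Cat.{v₂, u₂}}

/-- An arrow `(x, x') ⟶ (y, y')` is a pair of `f : x ⟶ y` and `(F f) x' ⟶ y'`. -/
structure Hom (X Y : Elements F) where
  /-- The arrow of the base. -/
  base : X.base ⟶ Y.base
  /-- The arrow of the category over its codomain. -/
  fiber : (F.map base).toFunctor.obj X.fiber ⟶ Y.fiber

/-- A 2-cell `(f, f') ⟶ (g, g')` is a 2-cell `α : f ⟶ g` of the base together with a 2-cell from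
`f'` to `(F α) ≫ g'`; as the fibers have only identity 2-cells, the latter is an equality. -/
@[ext]
structure Hom₂ {X Y : Elements F} (f g : Hom X Y) where
  /-- The 2-cell of the base. -/
  base : f.base ⟶ g.base
  w : (F.map₂ base).toNatTrans.app X.fiber ≫ g.fiber = f.fiber

instance : CategoryStruct (Elements F) where
  Hom X Y := Hom X Y
  id X := ⟨𝟙 X.base, (F.mapId X.base).hom.toNatTrans.app X.fiber⟩
  comp {X _ _} f g := ⟨f.base ≫ g.base,
    (F.mapComp f.base g.base).hom.toNatTrans.app X.fiber ≫
      (F.map g.base).toFunctor.map f.fiber ≫ g.fiber⟩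

instance (X Y : Elements F) : Category (X ⟶ Y) where
  Hom f g := Hom₂ f g
  id f := ⟨𝟙 f.base, by simp⟩
  comp η θ := ⟨η.base ≫ θ.base, by simp [θ.w, η.w]⟩

section

variable {X Y Z T : Elements F}

@[simp] lemma id_base (X : Elements F) : Hom.base (𝟙 X) = 𝟙 X.base := rfl

@[simp] lemma id_fiber (X : Elements F) :
    Hom.fiber (𝟙 X) = (F.mapId X.base).hom.toNatTrans.app X.fiber := rfl

@[simp] lemma comp_base (f : X ⟶ Y) (g : Y ⟶ Z) : (f ≫ g).base = f.base ≫ g.base := rfl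

@[simp] lemma comp_fiber (f : X ⟶ Y) (g : Y ⟶ Z) :
    (f ≫ g).fiber = (F.mapComp f.base g.base).hom.toNatTrans.app X.fiber ≫
      (F.map g.base).toFunctor.map f.fiber ≫ g.fiber := rfl

@[simp] lemma id₂_base (f : X ⟶ Y) : Hom₂.base (𝟙 f) = 𝟙 f.base := rfl

@[simp] lemma comp₂_base {f g h : X ⟶ Y} (η : f ⟶ g) (θ : g ⟶ h) :
    (η ≫ θ).base = η.base ≫ θ.base := rfl

@[ext]
lemma hom₂_ext {f g : X ⟶ Y} {η θ : f ⟶ g} (h : η.base = θ.base) : η = θ :=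
  Hom₂.ext h

/-- The 2-cell of `Elements F` given by a compatible 2-cell of the base. -/
def homMk {f g : X ⟶ Y} (α : f.base ⟶ g.base)
    (w : (F.map₂ α).toNatTrans.app X.fiber ≫ g.fiber = f.fiber) : f ⟶ g :=
  Hom₂.mk α w

@[simp] lemma homMk_base {f g : X ⟶ Y} (α : f.base ⟶ g.base)
    (w : (F.map₂ α).toNatTrans.app X.fiber ≫ g.fiber = f.fiber) : (homMk α w).base = α := rfl

/-- The invertible 2-cell of `Elements F` given by a compatible invertible 2-cell of the base. -/
def isoMk {f g : X ⟶ Y} (e : f.base ≅ g.base)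
    (w : (F.map₂ e.hom).toNatTrans.app X.fiber ≫ g.fiber = f.fiber) : f ≅ g where
  hom := homMk e.hom w
  inv := homMk e.inv (by
    rw [← w, ← Category.assoc, ← Cat.Hom₂.comp_app, ← F.map₂_comp]
    simp)
  hom_inv_id := by ext; simp
  inv_hom_id := by ext; simp

@[simp] lemma isoMk_hom_base {f g : X ⟶ Y} (e : f.base ≅ g.base)
    (w : (F.map₂ e.hom).toNatTrans.app X.fiber ≫ g.fiber = f.fiber) :
    (isoMk e w).hom.base = e.hom := rfl

@[simp] lemma isoMk_inv_base {f g : X ⟶ Y} (e : f.base ≅ g.base)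
    (w : (F.map₂ e.hom).toNatTrans.app X.fiber ≫ g.fiber = f.fiber) :
    (isoMk e w).inv.base = e.inv := rfl

end

lemma whiskerLeft_w {X Y Z : Elements F} (f : X ⟶ Y) {g h : Y ⟶ Z} (η : g ⟶ h) :
    (F.map₂ (f.base ◁ η.base)).toNatTrans.app X.fiber ≫ (f ≫ h).fiber = (f ≫ g).fiber := by
  have h₁ := η.w
  have h₂ := (F.map₂ η.base).toNatTrans.naturality f.fiber
  simp only [comp_fiber, ← h₁]
  simp [reassoc_of% h₂]

lemma whiskerRight_w {X Y Z : Elements F} {f g : X ⟶ Y} (η : f ⟶ g) (h : Y ⟶ Z) :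
    (F.map₂ (η.base ▷ h.base)).toNatTrans.app X.fiber ≫ (g ≫ h).fiber = (f ≫ h).fiber := by
  have h₁ := η.w
  simp only [comp_fiber, ← h₁]
  simp

lemma associator_w {X Y Z T : Elements F} (f : X ⟶ Y) (g : Y ⟶ Z) (h : Z ⟶ T) :
    (F.map₂ (α_ f.base g.base h.base).hom).toNatTrans.app X.fiber ≫ (f ≫ g ≫ h).fiber =
      ((f ≫ g) ≫ h).fiber := by
  simp only [comp_fiber]
  simp

lemma leftUnitor_w {X Y : Elements F} (f : X ⟶ Y) :
    (F.map₂ (λ_ f.base).hom).toNatTrans.app X.fiber ≫ f.fiber = (𝟙 X ≫ f).fiber := by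
  simp only [comp_fiber]
  simp

lemma rightUnitor_w {X Y : Elements F} (f : X ⟶ Y) :
    (F.map₂ (ρ_ f.base).hom).toNatTrans.app X.fiber ≫ f.fiber = (f ≫ 𝟙 Y).fiber := by
  simp only [comp_fiber]
  simp

instance : Bicategory (Elements F) where
  whiskerLeft f _ _ η := homMk (f.base ◁ Hom₂.base η) (whiskerLeft_w f η)
  whiskerRight η h := homMk (Hom₂.base η ▷ h.base) (whiskerRight_w η h)
  associator f g h := isoMk (α_ f.base g.base h.base) (associator_w f g h)
  leftUnitor f := isoMk (λ_ f.base) (leftUnitor_w f)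
  rightUnitor f := isoMk (ρ_ f.base) (rightUnitor_w f)
  whiskerLeft_id _ _ := hom₂_ext (Bicategory.whiskerLeft_id _ _)
  whiskerLeft_comp _ _ _ _ _ _ := hom₂_ext (Bicategory.whiskerLeft_comp _ _ _)
  id_whiskerLeft _ := hom₂_ext (Bicategory.id_whiskerLeft _)
  comp_whiskerLeft _ _ _ _ _ := hom₂_ext (Bicategory.comp_whiskerLeft _ _ _)
  id_whiskerRight _ _ := hom₂_ext (Bicategory.id_whiskerRight _ _)
  comp_whiskerRight _ _ _ := hom₂_ext (Bicategory.comp_whiskerRight _ _ _)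
  whiskerRight_id _ := hom₂_ext (Bicategory.whiskerRight_id _)
  whiskerRight_comp _ _ _ := hom₂_ext (Bicategory.whiskerRight_comp _ _ _)
  whisker_assoc _ _ _ _ _ := hom₂_ext (Bicategory.whisker_assoc _ _ _)
  whisker_exchange _ _ := hom₂_ext (Bicategory.whisker_exchange _ _)
  pentagon _ _ _ _ := hom₂_ext (Bicategory.pentagon _ _ _ _)
  triangle _ _ := hom₂_ext (Bicategory.triangle _ _)

variable (F) in
/-- The projection from the bicategory of elements to the base. -/
def proj : Elements F ⥤ᵖ B where
  obj X := X.base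
  map f := f.base
  map₂ η := η.base
  mapId _ := Iso.refl _
  mapComp _ _ := Iso.refl _
  map₂_whisker_left f _ _ η := by
    change f.base ◁ Hom₂.base η = 𝟙 _ ≫ f.base ◁ Hom₂.base η ≫ 𝟙 _
    simp
  map₂_whisker_right η h := by
    change Hom₂.base η ▷ h.base = 𝟙 _ ≫ Hom₂.base η ▷ h.base ≫ 𝟙 _
    simp
  map₂_associator f g h := by
    change (α_ f.base g.base h.base).hom = 𝟙 _ ≫ 𝟙 (f.base ≫ g.base) ▷ h.base ≫
      (α_ f.base g.base h.base).hom ≫ f.base ◁ 𝟙 (g.base ≫ h.base) ≫ 𝟙 _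
    simp
  map₂_left_unitor f := by
    change (λ_ f.base).hom = 𝟙 _ ≫ 𝟙 (𝟙 _) ▷ f.base ≫ (λ_ f.base).hom
    simp
  map₂_right_unitor f := by
    change (ρ_ f.base).hom = 𝟙 _ ≫ f.base ◁ 𝟙 (𝟙 _) ≫ (ρ_ f.base).hom
    simp

end Elements

end Elements

/-! ### Pseudo-colimits in `Cat` -/

section Pseudocolimit

variable (B : Type u₁) [Bicategory.{w₁, v₁} B] {C : Type u₂} [Bicategory.{w₂, v₂} C]

/-- The constant pseudofunctor `Δ c`. -/
def const (c : C) : B ⥤ᵖ C where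
  obj _ := c
  map _ := 𝟙 c
  map₂ _ := 𝟙 (𝟙 c)
  mapId _ := Iso.refl _
  mapComp _ _ := (λ_ (𝟙 c)).symm

/-- The pseudonatural transformation `Δ g : Δ c ⟶ Δ d` with all components equal to `g`. -/
def constMap {c d : C} (g : c ⟶ d) : const B c ⟶ const B d where
  app _ := g
  naturality _ := λ_ g ≪≫ (ρ_ g).symm
  naturality_naturality _ := by
    change 𝟙 (𝟙 c) ▷ g ≫ (λ_ g ≪≫ (ρ_ g).symm).hom = (λ_ g ≪≫ (ρ_ g).symm).hom ≫ g ◁ 𝟙 (𝟙 d)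
    simp
  naturality_id _ := by
    change (λ_ g ≪≫ (ρ_ g).symm).hom ≫ g ◁ 𝟙 (𝟙 d) = 𝟙 (𝟙 c) ▷ g ≫ (λ_ g).hom ≫ (ρ_ g).inv
    simp
  naturality_comp _ _ := by
    change (λ_ g ≪≫ (ρ_ g).symm).hom ≫ g ◁ (λ_ (𝟙 d)).inv = (λ_ (𝟙 c)).inv ▷ g ≫
      (α_ _ _ _).hom ≫ 𝟙 c ◁ (λ_ g ≪≫ (ρ_ g).symm).hom ≫ (α_ _ _ _).inv ≫
        (λ_ g ≪≫ (ρ_ g).symm).hom ▷ 𝟙 d ≫ (α_ _ _ _).hom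
    simp

/-- The modification `Δ τ : Δ g ⟶ Δ h` with all components equal to `τ`. -/
def constMap₂ {c d : C} {g h : c ⟶ d} (τ : g ⟶ h) : constMap B g ⟶ constMap B h where
  as :=
    { app _ := τ
      naturality _ := by
        change 𝟙 c ◁ τ ≫ (λ_ h ≪≫ (ρ_ h).symm).hom = (λ_ g ≪≫ (ρ_ g).symm).hom ≫ τ ▷ 𝟙 d
        simp }

/-- A strict representation, by a category `L`, of the pseudo-cocone functor
`E ↦ [B, Cat](F, Δ E)` of `F : B ⥤ᵖ Cat`, where `[B, Cat]` is the bicategory of pseudofunctors,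
pseudonatural transformations and modifications: isomorphisms of categories
`Cat(L, E) ≅ [B, Cat](F, Δ E)` that are strictly 2-natural in the category `E`. -/
structure PseudocolimitRepresentation {B : Type u₁} [Bicategory.{w₁, v₁} B]
    (F : B ⥤ᵖ Cat.{v, u}) (L : Cat.{v, u}) where
  /-- The isomorphism of categories at `E`. -/
  functor (E : Cat.{v, u}) : (L ⟶ E) ⥤ (F ⟶ const B E)
  /-- The inverse of the isomorphism of categories at `E`. -/
  inverse (E : Cat.{v, u}) : (F ⟶ const B E) ⥤ (L ⟶ E)
  functor_comp_inverse (E : Cat.{v, u}) : functor E ⋙ inverse E = 𝟭 (L ⟶ E)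
  inverse_comp_functor (E : Cat.{v, u}) : inverse E ⋙ functor E = 𝟭 (F ⟶ const B E)
  /-- Naturality with respect to functors `G : E ⟶ E'`. -/
  naturality {E E' : Cat.{v, u}} (G : E ⟶ E') :
    functor E ⋙ postcomp F (constMap B G) = postcomp L G ⋙ functor E'
  /-- Naturality with respect to natural transformations `τ : G ⟶ G'`. -/
  naturality₂ {E E' : Cat.{v, u}} {G G' : E ⟶ E'} (τ : G ⟶ G') :
    Functor.whiskerLeft (functor E)
        ((postcomposing F (const B E) (const B E')).map (constMap₂ B τ)) ≫
      eqToHom (naturality G') =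
    eqToHom (naturality G) ≫
      Functor.whiskerRight ((postcomposing L E E').map τ) (functor E')

/-- `L` is a pseudo-colimit of `F`. -/
def IsPseudocolimit {B : Type u₁} [Bicategory.{w₁, v₁} B]
    (F : B ⥤ᵖ Cat.{v, u}) (L : Cat.{v, u}) : Prop :=
  Nonempty (PseudocolimitRepresentation F L)

end Pseudocolimit

end BicatColim

/-!
The bicategory of elements of `F : B ⥤ᵖ Cat` is generated by two kinds of arrows: the vertical ones
`Elements.vert x φ`, lying over `𝟙 x`, and the horizontal ones `Elements.cart f a`, whose component
in the fiber is an identity. Every arrow is, up to an invertible 2-cell, a horizontal arrow followed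
by a vertical one (`Elements.cartCompVert`). Since 2-cells become equalities in `π₀`, a functor
`K : π₀ (∫ F) ⥤ E` restricts to functors `F x ⥤ E` (`Elements.fiberInclusion`), and the horizontal
arrows give natural transformations between them (`Elements.fiberInclusionMap`) that satisfy the
axioms of a pseudo-cocone, except that they need not be invertible. Conversely, a pseudo-cocone `σ`
gives the functor `(x, a) ↦ σ_x a`, `(f, φ) ↦ σ_y φ ∘ σ_f⁻¹`. These two constructions
(`coconeOfFunctor` and `functorOfCocone`) are mutually inverse bijections between pseudo-cocones and
functors on `π₀ (∫ F)` that invert the horizontal arrows.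

It remains to see that a functor inverts the horizontal arrows exactly when it inverts the classes
of co-Cartesian arrows (`classes_isCoCartesian_isInvertedBy_iff`). This holds because `(f, φ)` is
co-Cartesian if and only if `φ` is invertible (`Elements.isIso_fiber_of_isCoCartesian`,
`Elements.isCoCartesian_of_isIso_fiber`). The strict universal property of the localization then
identifies pseudo-cocones with functors on the localization. On 2-cells, a modification is the same
as a natural transformation of the corresponding functors (`functorOfCoconeMap`), so that
`toCoconeFunctor` is fully faithful and bijective on objects, hence an isomorphism of categories.
-/

namespace BicatColim

/-! ### Vertical and horizontal arrows of the bicategory of elements -/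

namespace Elements

variable {B : Type u₁} [Bicategory.{w₁, v₁} B] {F : B ⥤ᵖ Cat.{v₂, u₂}}

/-- The arrow `(x, a) ⟶ (x, a')` of the bicategory of elements over `𝟙 x` given by an arrow
`a ⟶ a'` of `F x`. -/
def vert (x : B) {a a' : F.obj x} (φ : a ⟶ a') : (⟨x, a⟩ : Elements F) ⟶ ⟨x, a'⟩ :=
  Hom.mk (𝟙 x) ((F.mapId x).hom.toNatTrans.app a ≫ φ)

/-- The arrow `(x, a) ⟶ (y, (F f) a)` of the bicategory of elements given by an arrow `f : x ⟶ y`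
of the base. -/
def cart {x y : B} (f : x ⟶ y) (a : F.obj x) :
    (⟨x, a⟩ : Elements F) ⟶ ⟨y, (F.map f).toFunctor.obj a⟩ :=
  Hom.mk f (𝟙 _)

@[simp] lemma vert_base (x : B) {a a' : F.obj x} (φ : a ⟶ a') : (vert x φ).base = 𝟙 x := rfl

@[simp] lemma vert_fiber (x : B) {a a' : F.obj x} (φ : a ⟶ a') :
    (vert x φ).fiber = (F.mapId x).hom.toNatTrans.app a ≫ φ := rfl

@[simp] lemma cart_base {x y : B} (f : x ⟶ y) (a : F.obj x) : (cart f a).base = f := rfl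

@[simp] lemma cart_fiber {x y : B} (f : x ⟶ y) (a : F.obj x) : (cart f a).fiber = 𝟙 _ := rfl

@[simp] lemma vert_id (X : Elements F) : vert X.base (𝟙 X.fiber) = 𝟙 X :=
  congrArg (Hom.mk (𝟙 X.base)) (Category.comp_id _)

/-- Every arrow of the bicategory of elements is, up to an invertible 2-cell, a horizontal arrow
followed by a vertical one. -/
def cartCompVert {X Y : Elements F} (f : X ⟶ Y) : cart f.base X.fiber ≫ vert Y.base f.fiber ≅ f :=
  isoMk (ρ_ f.base) (by simp only [comp_fiber]; simp)

/-- Vertical arrows compose as in the fiber, up to an invertible 2-cell. -/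
def vertCompVert (x : B) {a a' a'' : F.obj x} (φ : a ⟶ a') (ψ : a' ⟶ a'') :
    vert x φ ≫ vert x ψ ≅ vert x (φ ≫ ψ) :=
  isoMk (λ_ (𝟙 x)) (by simp only [comp_fiber]; simp)

/-- Horizontal arrows over `f` are natural in the object of the fiber. -/
def vertCompCart {x y : B} (f : x ⟶ y) {a a' : F.obj x} (φ : a ⟶ a') :
    vert x φ ≫ cart f a' ≅ cart f a ≫ vert y ((F.map f).toFunctor.map φ) :=
  let h : (⟨x, a⟩ : Elements F) ⟶ ⟨y, (F.map f).toFunctor.obj a'⟩ :=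
    Hom.mk f ((F.map f).toFunctor.map φ)
  isoMk (g := h) (λ_ f) (by simp only [comp_fiber]; simp [h]) ≪≫ (cartCompVert h).symm

/-- Horizontal arrows are compatible with the 2-cells of the base. This 2-cell need not be
invertible, as `η` need not be. -/
def cartMap₂ {x y : B} {f g : x ⟶ y} (η : f ⟶ g) (a : F.obj x) :
    cart f a ≫ vert y ((F.map₂ η).toNatTrans.app a) ⟶ cart g a :=
  homMk ((ρ_ f).hom ≫ η) (by simp only [comp_fiber]; simp)

/-- The horizontal arrow over an identity is, up to an invertible 2-cell, a section of the vertical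
arrow given by the unit constraint of `F`. -/
def cartId (x : B) (a : F.obj x) :
    cart (𝟙 x) a ≫ vert x ((F.mapId x).hom.toNatTrans.app a) ≅ 𝟙 (⟨x, a⟩ : Elements F) :=
  isoMk (λ_ (𝟙 x)) (by simp only [comp_fiber]; simp)

/-- The horizontal arrow over a composite is a composite of horizontal arrows, up to the composition
constraint of `F`. -/
def cartComp {x y z : B} (f : x ⟶ y) (g : y ⟶ z) (a : F.obj x) :
    cart (f ≫ g) a ≫ vert z ((F.mapComp f g).hom.toNatTrans.app a) ≅
      cart f a ≫ cart g ((F.map f).toFunctor.obj a) :=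
  isoMk (ρ_ (f ≫ g)) (by simp only [comp_fiber]; simp)

/-! ### co-Cartesian arrows of the bicategory of elements -/

/-- A co-Cartesian arrow has an invertible component in the fiber: essential surjectivity of the
comparison functor yields a right inverse of this component, and fullness shows that it is also a
left inverse. -/
lemma isIso_fiber_of_isCoCartesian {X Y : Elements F} {f : X ⟶ Y}
    (hf : IsCoCartesian (proj F) f) : IsIso f.fiber := by
  obtain ⟨x, a⟩ := X
  obtain ⟨y, b⟩ := Y
  obtain ⟨f, f'⟩ := f
  change x ⟶ y at f
  change (F.map f).toFunctor.obj a ⟶ b at f'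
  let Z : Elements F := ⟨y, (F.map f).toFunctor.obj a⟩
  -- The inverse of `f'` is extracted from a factorization through `(f, f')` of the horizontal arrow
  -- over `f`, the second factor lying over a 1-cell isomorphic to `𝟙 y`.
  let t : Limits.CategoricalPullback ((proj F).mapFunctor ⟨x, a⟩ Z)
      (precomp ((proj F).obj Z) ((proj F).map (Y := ⟨y, b⟩) (Hom.mk f f'))) :=
    ⟨cart f a, 𝟙 y, (ρ_ f).symm⟩
  obtain ⟨⟨g, g'⟩, ⟨e⟩⟩ : ∃ g, Nonempty ((coCartesianComparison (proj F) _ Z).obj g ≅ t) :=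
    (hf Z).essSurj.mem_essImage t
  change y ⟶ y at g
  change (F.map g).toFunctor.obj b ⟶ (F.map f).toFunctor.obj a at g'
  let δ : g ≅ 𝟙 y := (Limits.CategoricalPullback.π₂ _ _).mapIso e
  let γ : f ≫ g ⟶ f := e.hom.fst.base
  have hγ : γ = f ◁ δ.hom ≫ (ρ_ f).hom := by
    have : γ ≫ (ρ_ f).inv = 𝟙 _ ≫ f ◁ δ.hom := e.hom.w
    simpa [Iso.comp_inv_eq] using this
  have hγw : (F.map₂ γ).toNatTrans.app a ≫ 𝟙 _ = (F.mapComp f g).hom.toNatTrans.app a ≫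
      (F.map g).toFunctor.map f' ≫ g' := e.hom.fst.w
  have hγ' : (F.map₂ δ.hom).toNatTrans.app ((F.map f).toFunctor.obj a) ≫
      (F.mapId y).hom.toNatTrans.app _ = (F.map g).toFunctor.map f' ≫ g' := by
    rw [← cancel_epi ((F.mapComp f g).hom.toNatTrans.app a)]
    simpa [hγ] using hγw
  let r : b ⟶ (F.map f).toFunctor.obj a :=
    (F.mapId y).inv.toNatTrans.app b ≫ (F.map₂ δ.inv).toNatTrans.app b ≫ g'
  have h₁ : f' ≫ r = 𝟙 _ := by
    have n₁ := (F.mapId y).inv.toNatTrans.naturality f'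
    have n₂ := (F.map₂ δ.inv).toNatTrans.naturality f'
    simp only [Cat.Hom.id_toFunctor, Functor.id_map] at n₁
    dsimp only [r]
    rw [reassoc_of% n₁, reassoc_of% n₂, ← hγ']
    simp [← Cat.Hom₂.comp_app_assoc, ← F.map₂_comp]
  have h₂ : r ≫ f' = 𝟙 _ := by
    -- As `f' ≫ r = 𝟙`, the arrows `vert (r ≫ f')` and `vert 𝟙` become isomorphic after composition
    -- with `(f, f')`; by fullness they are related by a 2-cell over `𝟙 (𝟙 y)`, hence equal.
    let m : (coCartesianComparison (proj F) (X := ⟨x, a⟩) (Hom.mk f f') ⟨y, b⟩).obj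
        (vert y (r ≫ f')) ⟶ (coCartesianComparison (proj F) _ ⟨y, b⟩).obj (vert y (𝟙 b)) :=
      { fst := homMk (𝟙 (f ≫ 𝟙 y)) (by
          simp only [coCartesianComparison, comp_fiber]
          simp [reassoc_of% h₁])
        snd := 𝟙 (𝟙 y)
        w := by
          change 𝟙 (f ≫ 𝟙 y) ≫ 𝟙 _ = 𝟙 _ ≫ f ◁ 𝟙 (𝟙 y)
          simp }
    obtain ⟨η, hη⟩ := (hf ⟨y, b⟩).full.map_surjective m
    have hη' : η.base = 𝟙 (𝟙 y) := congr(Limits.CategoricalPullback.Hom.snd $hη)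
    have := η.w
    rw [hη'] at this
    rw [← cancel_epi ((F.mapId y).hom.toNatTrans.app b)]
    simpa using this.symm
  exact ⟨r, h₁, h₂⟩

/-- An arrow with an invertible component in the fiber is co-Cartesian: the comparison functor is
always faithful, and the inverse of this component provides the 2-cells and the arrows that make it
full and essentially surjective. -/
lemma isCoCartesian_of_isIso_fiber {X Y : Elements F} (f : X ⟶ Y) (hf : IsIso f.fiber) :
    IsCoCartesian (proj F) f := by
  intro Z
  obtain ⟨x, a⟩ := X
  obtain ⟨y, b⟩ := Y
  obtain ⟨f, φ⟩ := f
  obtain ⟨z, c⟩ := Z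
  change x ⟶ y at f
  change (F.map f).toFunctor.obj a ⟶ b at φ
  obtain ⟨ψ, hφψ, -⟩ : ∃ ψ : b ⟶ (F.map f).toFunctor.obj a, φ ≫ ψ = 𝟙 _ ∧ ψ ≫ φ = 𝟙 _ :=
    hf.out
  refine { faithful := ⟨fun h => hom₂_ext congr(Limits.CategoricalPullback.Hom.snd $h)⟩
           full := ⟨fun {g h} m => ?_⟩
           essSurj := ⟨fun ⟨h, k, e⟩ => ?_⟩ }
  · obtain ⟨g, g'⟩ := g
    obtain ⟨h, h'⟩ := h
    change y ⟶ z at g h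
    change (F.map g).toFunctor.obj b ⟶ c at g'
    change (F.map h).toFunctor.obj b ⟶ c at h'
    let β : g ⟶ h := m.snd
    have hm : m.fst.base = f ◁ β := by
      have : m.fst.base ≫ 𝟙 (f ≫ h) = 𝟙 (f ≫ g) ≫ f ◁ β := m.w
      exact (Category.comp_id _).symm.trans (this.trans (Category.id_comp _))
    have hβ : (F.map₂ (f ◁ β)).toNatTrans.app a ≫ (F.mapComp f h).hom.toNatTrans.app a ≫
        (F.map h).toFunctor.map φ ≫ h' =
          (F.mapComp f g).hom.toNatTrans.app a ≫ (F.map g).toFunctor.map φ ≫ g' := by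
      rw [← hm]
      exact m.fst.w
    refine ⟨homMk β ?_, Limits.CategoricalPullback.Hom.ext (hom₂_ext hm.symm) rfl⟩
    have : IsIso φ := hf
    rw [← cancel_epi ((F.map g).toFunctor.map φ),
      ← cancel_epi ((F.mapComp f g).hom.toNatTrans.app a), ← hβ]
    simp
  · obtain ⟨h, h'⟩ := h
    change x ⟶ z at h
    change y ⟶ z at k
    change (F.map h).toFunctor.obj a ⟶ c at h'
    change h ≅ f ≫ k at e
    let k' : (⟨y, b⟩ : Elements F) ⟶ ⟨z, c⟩ := Hom.mk k ((F.map k).toFunctor.map ψ ≫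
      (F.mapComp f k).inv.toNatTrans.app a ≫ (F.map₂ e.inv).toNatTrans.app a ≫ h')
    refine ⟨k', ⟨Limits.CategoricalPullback.mkIso (isoMk e.symm ?_) (Iso.refl _) ?_⟩⟩
    · simp only [coCartesianComparison, comp_fiber]
      simp [k', ← Functor.map_comp_assoc, hφψ]
    · change e.inv ≫ e.hom = 𝟙 (f ≫ k) ≫ f ◁ 𝟙 k
      simp

end Elements

/-! ### Functors on `π₀` of the bicategory of elements -/

namespace PiZero

section

variable {B : Type u} [Bicategory.{w, v} B]

lemma arrowClass_surjective {X Y : PiZero B} (f : X ⟶ Y) : ∃ g : X.as ⟶ Y.as, arrowClass g = f :=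
  Quotient.exists_rep f

lemma arrowClass_eq {X Y : B} {f g : X ⟶ Y} (η : f ⟶ g) : arrowClass f = arrowClass g :=
  Quotient.sound (Zigzag.of_hom η)

/-- The functor on `π₀ B` given by a map on the objects and the arrows of `B` that is functorial and
identifies arrows related by a 2-cell. -/
def lift {C : Type u₁} [Category.{v₁} C] (obj : B → C)
    (map : ∀ {X Y : B}, (X ⟶ Y) → (obj X ⟶ obj Y))
    (map_eq : ∀ {X Y : B} {f g : X ⟶ Y}, (f ⟶ g) → map f = map g)
    (map_id : ∀ X, map (𝟙 X) = 𝟙 (obj X))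
    (map_comp : ∀ {X Y Z : B} (f : X ⟶ Y) (g : Y ⟶ Z), map (f ≫ g) = map f ≫ map g) :
    PiZero B ⥤ C where
  obj X := obj X.as
  map {X Y} := Quotient.lift map fun f g h => by
    induction h with
    | refl => rfl
    | tail _ h ih => exact ih.trans (h.elim (fun ⟨η⟩ => map_eq η) fun ⟨η⟩ => (map_eq η).symm)
  map_id X := map_id X.as
  map_comp := by
    rintro X Y Z ⟨f⟩ ⟨g⟩
    exact map_comp f g

end

end PiZero

namespace Elements

open PiZero

variable {B : Type u₁} [Bicategory.{w₁, v₁} B] (F : B ⥤ᵖ Cat.{v₂, u₂})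

/-- The inclusion of the category `F x` in `π₀` of the bicategory of elements of `F`. -/
@[simps]
def fiberInclusion (x : B) : F.obj x ⥤ PiZero (Elements F) where
  obj a := of ⟨x, a⟩
  map φ := arrowClass (vert x φ)
  map_id a := congrArg arrowClass (vert_id ⟨x, a⟩)
  map_comp φ ψ := (arrowClass_eq (vertCompVert x φ ψ).inv)

/-- The natural transformation with components the classes of the horizontal arrows over `f`. -/
@[simps]
def fiberInclusionMap {x y : B} (f : x ⟶ y) :
    fiberInclusion F x ⟶ (F.map f).toFunctor ⋙ fiberInclusion F y where
  app a := arrowClass (cart f a)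
  naturality _ _ φ := arrowClass_eq (vertCompCart f φ).hom

variable {F}

lemma arrowClass_eq_comp {X Y : Elements F} (f : X ⟶ Y) :
    arrowClass f =
      (fiberInclusionMap F f.base).app X.fiber ≫ (fiberInclusion F Y.base).map f.fiber :=
  arrowClass_eq (cartCompVert f).inv

lemma fiberInclusionMap_naturality {x y : B} {f g : x ⟶ y} (η : f ⟶ g) (a : F.obj x) :
    (fiberInclusionMap F f).app a ≫
      (fiberInclusion F y).map ((F.map₂ η).toNatTrans.app a) = (fiberInclusionMap F g).app a :=
  arrowClass_eq (cartMap₂ η a)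

lemma fiberInclusionMap_id (x : B) (a : F.obj x) :
    (fiberInclusionMap F (𝟙 x)).app a ≫
      (fiberInclusion F x).map ((F.mapId x).hom.toNatTrans.app a) = 𝟙 _ :=
  arrowClass_eq (cartId x a).hom

lemma fiberInclusionMap_comp {x y z : B} (f : x ⟶ y) (g : y ⟶ z) (a : F.obj x) :
    (fiberInclusionMap F (f ≫ g)).app a ≫
      (fiberInclusion F z).map ((F.mapComp f g).hom.toNatTrans.app a) =
    (fiberInclusionMap F f).app a ≫ (fiberInclusionMap F g).app ((F.map f).toFunctor.obj a) :=
  arrowClass_eq (cartComp f g a).hom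

end Elements

/-! ### Pseudo-cocones in components -/

namespace PseudoCocone

variable {B : Type u₁} [Bicategory.{w₁, v₁} B] {F : B ⥤ᵖ Cat.{v₂, u₂}} {E : Cat.{v₂, u₂}}

/-- Constructor for pseudo-cocones under `F`. A structural isomorphism is given in the direction
`leg x ⟶ F f ⋙ leg y` of the horizontal arrows, opposite to that of
`Pseudofunctor.StrongTrans.naturality`. In components, the coherence isomorphisms of `Cat` and the
structural 2-cells of `const B E` are identities, which leaves the stated axioms. -/
def mk (leg : ∀ x, F.obj x ⥤ E)
    (iso : ∀ {x y : B} (f : x ⟶ y), leg x ≅ (F.map f).toFunctor ⋙ leg y)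
    (iso_naturality : ∀ {x y : B} {f g : x ⟶ y} (η : f ⟶ g) (a : F.obj x),
      (iso f).hom.app a ≫ (leg y).map ((F.map₂ η).toNatTrans.app a) = (iso g).hom.app a)
    (iso_id : ∀ (x : B) (a : F.obj x),
      (iso (𝟙 x)).hom.app a ≫ (leg x).map ((F.mapId x).hom.toNatTrans.app a) = 𝟙 _)
    (iso_comp : ∀ {x y z : B} (f : x ⟶ y) (g : y ⟶ z) (a : F.obj x),
      (iso (f ≫ g)).hom.app a ≫ (leg z).map ((F.mapComp f g).hom.toNatTrans.app a) =
        (iso f).hom.app a ≫ (iso g).hom.app ((F.map f).toFunctor.obj a)) :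
    F ⟶ const B E where
  app x := (leg x).toCatHom
  naturality f := (Cat.Hom.isoMk (iso f)).symm
  naturality_naturality {x y f g} η := Cat.Hom₂.ext <| NatTrans.ext <| funext fun a => by
    change (leg y).map ((F.map₂ η).toNatTrans.app a) ≫ (iso g).inv.app a = (iso f).inv.app a ≫ 𝟙 _
    rw [← cancel_epi ((iso f).hom.app a), reassoc_of% (iso_naturality η a)]
    simp
  naturality_id x := Cat.Hom₂.ext <| NatTrans.ext <| funext fun a => by
    change (iso (𝟙 x)).inv.app a ≫ 𝟙 _ =
      (leg x).map ((F.mapId x).hom.toNatTrans.app a) ≫ 𝟙 _ ≫ 𝟙 _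
    rw [← cancel_epi ((iso (𝟙 x)).hom.app a), reassoc_of% (iso_id x a)]
    simp
  naturality_comp {x y z} f g := Cat.Hom₂.ext <| NatTrans.ext <| funext fun a => by
    change (iso (f ≫ g)).inv.app a ≫ 𝟙 _ = (leg z).map ((F.mapComp f g).hom.toNatTrans.app a) ≫
      𝟙 _ ≫ (iso g).inv.app ((F.map f).toFunctor.obj a) ≫ 𝟙 _ ≫ (iso f).inv.app a ≫ 𝟙 _
    rw [← cancel_epi ((iso (f ≫ g)).hom.app a), reassoc_of% (iso_comp f g a)]
    simp

variable (σ : F ⟶ const B E)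

/-- The functor `F x ⥤ E` underlying a component of a pseudo-cocone. -/
def leg (x : B) : F.obj x ⥤ E := (σ.app x).toFunctor

/-- The inverse of the structural isomorphism at `f` of a pseudo-cocone. -/
def iso {x y : B} (f : x ⟶ y) :
    leg σ x ≅ (F.map f).toFunctor ⋙ leg σ y :=
  Cat.Hom.toNatIso (σ.naturality f).symm

lemma iso_naturality {x y : B} {f g : x ⟶ y} (η : f ⟶ g) (a : F.obj x) :
    (iso σ f).hom.app a ≫ (leg σ y).map ((F.map₂ η).toNatTrans.app a) =
      (iso σ g).hom.app a := by
  have h : (leg σ y).map ((F.map₂ η).toNatTrans.app a) ≫ (iso σ g).inv.app a =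
      (iso σ f).inv.app a ≫ 𝟙 _ := congr(($(σ.naturality_naturality η)).toNatTrans.app a)
  rw [← cancel_mono ((iso σ g).inv.app a), Category.assoc, h]
  simp

lemma iso_id (x : B) (a : F.obj x) :
    (iso σ (𝟙 x)).hom.app a ≫ (leg σ x).map ((F.mapId x).hom.toNatTrans.app a) = 𝟙 _ := by
  have h : (iso σ (𝟙 x)).inv.app a ≫ 𝟙 _ = (leg σ x).map
      ((F.mapId x).hom.toNatTrans.app a) ≫ 𝟙 _ ≫ 𝟙 _ :=
    congr(($(σ.naturality_id x)).toNatTrans.app a)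
  simp only [Category.comp_id] at h
  rw [← h]
  simp

lemma iso_comp {x y z : B} (f : x ⟶ y) (g : y ⟶ z) (a : F.obj x) :
    (iso σ (f ≫ g)).hom.app a ≫
      (leg σ z).map ((F.mapComp f g).hom.toNatTrans.app a) =
    (iso σ f).hom.app a ≫ (iso σ g).hom.app ((F.map f).toFunctor.obj a) := by
  have h : (iso σ (f ≫ g)).inv.app a ≫ 𝟙 _ =
      (leg σ z).map ((F.mapComp f g).hom.toNatTrans.app a) ≫
        𝟙 _ ≫ (iso σ g).inv.app ((F.map f).toFunctor.obj a) ≫ 𝟙 _ ≫ (iso σ f).inv.app a ≫ 𝟙 _ :=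
    congr(($(σ.naturality_comp f g)).toNatTrans.app a)
  rw [← cancel_mono ((iso σ g).inv.app _), ← cancel_mono ((iso σ f).inv.app a)]
  simp only [Category.id_comp, Category.comp_id] at h
  simp only [Category.assoc]
  rw [← h]
  simp

/-- Pseudo-cocones are equal if they have the same legs, up to equality of functors, and the same
structural isomorphisms. -/
lemma ext {σ τ : F ⟶ const B E}
    (obj : ∀ (x : B) (a : F.obj x), (leg σ x).obj a = (leg τ x).obj a)
    (map : ∀ (x : B) {a a' : F.obj x} (φ : a ⟶ a'), (leg σ x).map φ =
      eqToHom (obj x a) ≫ (leg τ x).map φ ≫ eqToHom (obj x a').symm)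
    (iso : ∀ {x y : B} (f : x ⟶ y) (a : F.obj x), (iso σ f).hom.app a =
      eqToHom (obj x a) ≫ (PseudoCocone.iso τ f).hom.app a ≫ eqToHom (obj y _).symm) :
    σ = τ := by
  obtain ⟨σ, σn, _, _, _⟩ := σ
  obtain ⟨τ, τn, _, _, _⟩ := τ
  obtain rfl : σ = τ := funext fun x => Cat.ext <|
    CategoryTheory.Functor.ext (obj x) fun _ _ φ => map x φ
  obtain rfl : @σn = @τn := by
    funext x y f
    apply Iso.symm_eq_iff.1
    refine Iso.ext <| Cat.Hom₂.ext <| NatTrans.ext <| funext fun a => ?_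
    exact (iso f a).trans ((Category.id_comp _).trans (Category.comp_id _))
  rfl

variable {σ} {τ : F ⟶ const B E}

/-- Constructor for modifications of pseudo-cocones. -/
def homMk (t : ∀ x, leg σ x ⟶ leg τ x)
    (ht : ∀ {x y : B} (f : x ⟶ y) (a : F.obj x),
      (iso σ f).hom.app a ≫ (t y).app ((F.map f).toFunctor.obj a) =
        (t x).app a ≫ (iso τ f).hom.app a) : σ ⟶ τ where
  as :=
    { app x := .ofNatTrans (t x)
      naturality {x y} f := Cat.Hom₂.ext <| NatTrans.ext <| funext fun a => by
        change (t y).app ((F.map f).toFunctor.obj a) ≫ (iso τ f).inv.app a =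
          (iso σ f).inv.app a ≫ (t x).app a
        rw [← cancel_epi ((iso σ f).hom.app a), reassoc_of% ht f a]
        simp }

/-- The component at `x` of a modification of pseudo-cocones. -/
def homApp (m : σ ⟶ τ) (x : B) : leg σ x ⟶ leg τ x := (m.as.app x).toNatTrans

lemma homApp_naturality (m : σ ⟶ τ) {x y : B} (f : x ⟶ y) (a : F.obj x) :
    (iso σ f).hom.app a ≫ (homApp m y).app ((F.map f).toFunctor.obj a) =
      (homApp m x).app a ≫ (iso τ f).hom.app a := by
  have h : (homApp m y).app ((F.map f).toFunctor.obj a) ≫ (iso τ f).inv.app a =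
      (iso σ f).inv.app a ≫ (homApp m x).app a :=
    congr(($(m.as.naturality f)).toNatTrans.app a)
  rw [← cancel_mono ((iso τ f).inv.app a), Category.assoc, h]
  simp

lemma hom_ext {m n : σ ⟶ τ} (h : ∀ x (a : F.obj x), (homApp m x).app a = (homApp n x).app a) :
    m = n :=
  Pseudofunctor.StrongTrans.homCategory.ext fun x =>
    Cat.Hom₂.ext <| NatTrans.ext <| funext fun a => h x a

@[simp]
lemma homApp_comp {ρ : F ⟶ const B E} (m : σ ⟶ τ) (n : τ ⟶ ρ) (x : B) (a : F.obj x) :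
    (homApp (m ≫ n) x).app a = (homApp m x).app a ≫ (homApp n x).app a := rfl

lemma iso_comp_constMap {E' : Cat.{v₂, u₂}} (σ : F ⟶ const B E) (G : E ⟶ E') {x y : B}
    (f : x ⟶ y) (a : F.obj x) :
    (iso (σ ≫ constMap B G) f).hom.app a = G.toFunctor.map ((iso σ f).hom.app a) := by
  have h := congr(($(Pseudofunctor.StrongTrans.categoryStruct_comp_naturality_inv
    σ (constMap B G) f)).toNatTrans.app a)
  refine Eq.trans h ?_
  change (((𝟙 _ ≫ (𝟙 _ ≫ 𝟙 _)) ≫ 𝟙 _) ≫ G.toFunctor.map ((iso σ f).hom.app a)) ≫ 𝟙 _ = _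
  simp

@[simp]
lemma homApp_eqToHom (h : σ = τ) (x : B) (a : F.obj x) :
    (homApp (eqToHom h) x).app a = eqToHom (by rw [h]) := by
  subst h
  rfl

lemma homApp_eqToHom_app {C : Type u} [Category.{v} C] {Φ Ψ : C ⥤ (F ⟶ const B E)} (h : Φ = Ψ)
    (K : C) (x : B) (a : F.obj x) :
    (homApp ((eqToHom h).app K) x).app a = eqToHom (by rw [h]) := by
  subst h
  rfl

end PseudoCocone

/-! ### Pseudo-cocones as functors on `π₀` of the bicategory of elements -/

section

open Elements PiZero

variable {B : Type u₁} [Bicategory.{w₁, v₁} B] {F : B ⥤ᵖ Cat.{v₂, u₂}} {E : Cat.{v₂, u₂}}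

/-- The pseudo-cocone under `F` with legs the restrictions to the fibers of a functor that inverts
the horizontal arrows. -/
noncomputable def coconeOfFunctor (K : PiZero (Elements F) ⥤ E)
    (hK : ∀ {x y : B} (f : x ⟶ y) (a : F.obj x), IsIso (K.map (arrowClass (cart f a)))) :
    F ⟶ const B E :=
  PseudoCocone.mk (fun x => fiberInclusion F x ⋙ K)
    (fun f => NatIso.ofComponents (fun a => @asIso _ _ _ _ _ (hK f a)) (fun φ =>
      (Functor.whiskerRight (fiberInclusionMap F f) K).naturality φ))
    (fun η a => (K.map_comp _ _).symm.trans (congrArg K.map (fiberInclusionMap_naturality η a)))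
    (fun x a => (K.map_comp _ _).symm.trans
      ((congrArg K.map (fiberInclusionMap_id x a)).trans (K.map_id _)))
    (fun f g a => (K.map_comp _ _).symm.trans
      ((congrArg K.map (fiberInclusionMap_comp f g a)).trans (K.map_comp _ _)))

/-- The functor on `π₀` of the bicategory of elements that sends `(x, a)` to the value at `a` of the
leg at `x` of a pseudo-cocone. -/
def functorOfCocone (σ : F ⟶ const B E) : PiZero (Elements F) ⥤ E :=
  PiZero.lift (fun X => (PseudoCocone.leg σ X.base).obj X.fiber)
    (fun {X Y} f => (PseudoCocone.iso σ f.base).hom.app X.fiber ≫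
      (PseudoCocone.leg σ Y.base).map f.fiber)
    (fun {X Y f g} η => by
      rw [← η.w, Functor.map_comp, ← PseudoCocone.iso_naturality σ η.base, Category.assoc])
    (fun X => PseudoCocone.iso_id σ _ _)
    (fun {X Y Z} f g => by
      have := (PseudoCocone.iso σ g.base).hom.naturality f.fiber
      dsimp at this
      simp [reassoc_of% PseudoCocone.iso_comp])

lemma functorOfCocone_map_arrowClass (σ : F ⟶ const B E) {X Y : Elements F} (f : X ⟶ Y) :
    (functorOfCocone σ).map (arrowClass f) = (PseudoCocone.iso σ f.base).hom.app X.fiber ≫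
      (PseudoCocone.leg σ Y.base).map f.fiber := rfl

instance isIso_functorOfCocone_map (σ : F ⟶ const B E) {x y : B} (f : x ⟶ y) (a : F.obj x) :
    IsIso ((functorOfCocone σ).map (arrowClass (cart f a))) := by
  rw [functorOfCocone_map_arrowClass]
  exact IsIso.comp_isIso' ((PseudoCocone.iso σ f).app a).isIso_hom
    (Functor.map_isIso (PseudoCocone.leg σ y) (𝟙 _))

/-- The natural transformation between the corresponding functors given by a modification of
pseudo-cocones. -/
@[simps]
def functorOfCoconeMap {σ τ : F ⟶ const B E} (m : σ ⟶ τ) :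
    functorOfCocone σ ⟶ functorOfCocone τ where
  app X := (PseudoCocone.homApp m X.as.base).app X.as.fiber
  naturality {X Y} f := by
    obtain ⟨f, rfl⟩ := arrowClass_surjective f
    have h := PseudoCocone.homApp_naturality m f.base X.as.fiber
    have h' := (PseudoCocone.homApp m Y.as.base).naturality f.fiber
    change ((PseudoCocone.iso σ f.base).hom.app X.as.fiber ≫
        (PseudoCocone.leg σ Y.as.base).map f.fiber) ≫ _ =
      _ ≫ (PseudoCocone.iso τ f.base).hom.app X.as.fiber ≫
        (PseudoCocone.leg τ Y.as.base).map f.fiber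
    rw [Category.assoc, h', reassoc_of% h]

lemma functorOfCocone_coconeOfFunctor_map (K : PiZero (Elements F) ⥤ E)
    (hK : ∀ {x y : B} (f : x ⟶ y) (a : F.obj x), IsIso (K.map (arrowClass (cart f a))))
    {X Y : PiZero (Elements F)} (f : X ⟶ Y) :
    (functorOfCocone (coconeOfFunctor K hK)).map f = K.map f := by
  obtain ⟨f, rfl⟩ := arrowClass_surjective f
  exact (K.map_comp _ _).symm.trans (congrArg K.map (arrowClass_eq_comp f).symm)

lemma functorOfCocone_coconeOfFunctor (K : PiZero (Elements F) ⥤ E)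
    (hK : ∀ {x y : B} (f : x ⟶ y) (a : F.obj x), IsIso (K.map (arrowClass (cart f a)))) :
    functorOfCocone (coconeOfFunctor K hK) = K :=
  CategoryTheory.Functor.ext (fun _ => rfl) (fun _ _ f =>
    (functorOfCocone_coconeOfFunctor_map K hK f).trans
      ((Category.id_comp _).trans (Category.comp_id _)).symm)

lemma coconeOfFunctor_functorOfCocone (σ : F ⟶ const B E)
    (hK : ∀ {x y : B} (f : x ⟶ y) (a : F.obj x),
      IsIso ((functorOfCocone σ).map (arrowClass (cart f a)))) :
    coconeOfFunctor (functorOfCocone σ) hK = σ :=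
  PseudoCocone.ext (fun _ _ => rfl)
    -- The legs agree definitionally on objects, so that all the `eqToHom` are identities.
    (fun x a a' φ => by
      refine Eq.trans ?_ ((Category.id_comp _).trans (Category.comp_id _)).symm
      change (PseudoCocone.iso σ (𝟙 x)).hom.app a ≫ (PseudoCocone.leg σ x).map
        ((F.mapId x).hom.toNatTrans.app a ≫ φ) = (PseudoCocone.leg σ x).map φ
      rw [Functor.map_comp, reassoc_of% PseudoCocone.iso_id])
    (fun {x y} f a => by
      refine Eq.trans ?_ ((Category.id_comp _).trans (Category.comp_id _)).symm
      change (PseudoCocone.iso σ f).hom.app a ≫ (PseudoCocone.leg σ y).map (𝟙 _) = _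
      rw [CategoryTheory.Functor.map_id]
      exact Category.comp_id _)

end

/-! ### Isomorphisms of categories -/

section

variable {C : Type u₁} [Category.{v₁} C] {D : Type u₂} [Category.{v₂} D]

/-- The strict inverse of a fully faithful functor that is bijective on objects. -/
noncomputable def strictInverse (Φ : C ⥤ D) [Φ.Full] [Φ.Faithful] (inv : D → C)
    (right_inv : ∀ Y, Φ.obj (inv Y) = Y) : D ⥤ C where
  obj := inv
  map {Y Z} f := Φ.preimage (eqToHom (right_inv Y) ≫ f ≫ eqToHom (right_inv Z).symm)
  map_id Y := Φ.map_injective (by simp)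
  map_comp f g := Φ.map_injective (by simp)

lemma strictInverse_comp (Φ : C ⥤ D) [Φ.Full] [Φ.Faithful] (inv : D → C)
    (right_inv : ∀ Y, Φ.obj (inv Y) = Y) : strictInverse Φ inv right_inv ⋙ Φ = 𝟭 D :=
  CategoryTheory.Functor.ext right_inv (fun _ _ f => by simp [strictInverse])

lemma comp_strictInverse (Φ : C ⥤ D) [Φ.Full] [Φ.Faithful] (inv : D → C)
    (left_inv : ∀ X, inv (Φ.obj X) = X)
    (right_inv : ∀ Y, Φ.obj (inv Y) = Y) : Φ ⋙ strictInverse Φ inv right_inv = 𝟭 C :=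
  CategoryTheory.Functor.ext left_inv (fun X Y f => Φ.map_injective (by
    have h := eqToHom_map Φ (left_inv Y).symm
    simp only [strictInverse, Functor.comp_map, Functor.map_preimage, Functor.map_comp,
      Functor.id_map, eqToHom_map Φ (left_inv X)]
    rw [h]))

end

/-! ### The localization of `π₀` of the bicategory of elements -/

section

open Elements PiZero

variable {B : Type u₁} [Bicategory.{w, v₁} B] {F : B ⥤ᵖ Cat.{v₂, u₂}}

/-- For functors on `π₀`, inverting co-Cartesian arrows amounts to inverting horizontal arrows: any
functor inverts the class of the vertical factor of a co-Cartesian arrow. -/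
lemma classes_isCoCartesian_isInvertedBy_iff {C : Type u} [Category.{v} C]
    (K : PiZero (Elements F) ⥤ C) :
    (classes (IsCoCartesian (proj F))).IsInvertedBy K ↔
      ∀ {x y : B} (f : x ⟶ y) (a : F.obj x), IsIso (K.map (arrowClass (cart f a))) := by
  refine ⟨fun hK x y f a => hK _ ⟨cart f a, isCoCartesian_of_isIso_fiber _ ?_, rfl⟩, ?_⟩
  · exact inferInstanceAs (IsIso (𝟙 ((F.map f).toFunctor.obj a)))
  · rintro hK X Y _ ⟨f, hf, rfl⟩
    have := isIso_fiber_of_isCoCartesian hf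
    have := hK f.base X.as.fiber
    have h : IsIso ((fiberInclusion F Y.as.base ⋙ K).map f.fiber) := inferInstance
    rw [show K.map (arrowClass f) = _ from
      (congrArg K.map (arrowClass_eq_comp f)).trans (K.map_comp _ _)]
    exact IsIso.comp_isIso' this h

end

section

open Elements PiZero

variable {B : Type u₁} [Bicategory.{w, v₁} B]
    (F : B ⥤ᵖ Cat.{max u₁ u₂ v₁ v₂, max u₁ u₂})

/-- The localization of `π₀` of the bicategory of elements at the classes of co-Cartesian arrows. -/
noncomputable abbrev localizedElements : Cat.{max u₁ u₂ v₁ v₂, max u₁ u₂} :=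
  Cat.of (classes (IsCoCartesian (proj F))).Localization

/-- The localization functor. -/
noncomputable abbrev toLocalizedElements : PiZero (Elements F) ⥤ localizedElements F :=
  (classes (IsCoCartesian (proj F))).Q

variable {F} {E : Cat.{max u₁ u₂ v₁ v₂, max u₁ u₂}}

lemma isIso_map_cart (K : localizedElements F ⟶ E) {x y : B} (f : x ⟶ y) (a : F.obj x) :
    IsIso ((toLocalizedElements F ⋙ K.toFunctor).map (arrowClass (cart f a))) :=
  (classes_isCoCartesian_isInvertedBy_iff _).1 (.of_comp _ _ (classes _).Q_inverts _) f a

/-- The pseudo-cocone corresponding to a functor on the localization. -/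
noncomputable def toCocone (K : localizedElements F ⟶ E) : F ⟶ const B E :=
  coconeOfFunctor (toLocalizedElements F ⋙ K.toFunctor) (isIso_map_cart K)

/-- The functor on the localization corresponding to a pseudo-cocone. -/
noncomputable def ofCocone (σ : F ⟶ const B E) : localizedElements F ⟶ E :=
  (Localization.Construction.lift (functorOfCocone σ)
    ((classes_isCoCartesian_isInvertedBy_iff _).2
      fun f a => isIso_functorOfCocone_map σ f a)).toCatHom

lemma toCocone_ofCocone (σ : F ⟶ const B E) : toCocone (ofCocone σ) = σ := by
  have h : toLocalizedElements F ⋙ (ofCocone σ).toFunctor = functorOfCocone σ :=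
    Localization.Construction.fac _ _
  refine Eq.trans ?_ (coconeOfFunctor_functorOfCocone σ (isIso_functorOfCocone_map σ))
  simp only [toCocone, h]

lemma ofCocone_toCocone (K : localizedElements F ⟶ E) : ofCocone (toCocone K) = K := by
  apply Cat.ext
  apply Localization.Construction.uniq
  have h : toLocalizedElements F ⋙ (ofCocone (toCocone K)).toFunctor =
    functorOfCocone (toCocone K) := Localization.Construction.fac _ _
  refine h.trans ?_
  exact functorOfCocone_coconeOfFunctor (toLocalizedElements F ⋙ K.toFunctor)
    (isIso_map_cart K)

/-- The functor from functors on the localization to pseudo-cocones. -/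
noncomputable def toCoconeFunctor (E : Cat.{max u₁ u₂ v₁ v₂, max u₁ u₂}) :
    (localizedElements F ⟶ E) ⥤ (F ⟶ const B E) where
  obj := toCocone
  map {K K'} t := PseudoCocone.homMk
    (fun x => Functor.whiskerLeft (fiberInclusion F x ⋙ toLocalizedElements F) t.toNatTrans)
    (fun f a => t.toNatTrans.naturality _)

instance : (toCoconeFunctor (F := F) E).Faithful where
  map_injective {K K'} t t' h := by
    refine Cat.Hom₂.ext <| NatTrans.ext <| funext fun X => ?_
    obtain ⟨⟨⟨x, a⟩⟩, rfl⟩ := (Localization.Construction.objEquiv _).surjective X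
    exact congr((PseudoCocone.homApp $h x).app a)

/-- A modification gives a natural transformation of functors on `π₀` of the bicategory of elements,
which extends to the localization. -/
instance : (toCoconeFunctor (F := F) E).Full where
  map_surjective {K K'} m := by
    let τ : toLocalizedElements F ⋙ K.toFunctor ⟶ toLocalizedElements F ⋙ K'.toFunctor :=
      { app X := (PseudoCocone.homApp m X.as.base).app X.as.fiber
        naturality X Y f := by
          have h := functorOfCocone_coconeOfFunctor_map _ (isIso_map_cart K) f
          have h' := functorOfCocone_coconeOfFunctor_map _ (isIso_map_cart K') f
          exact (congrArg (· ≫ (functorOfCoconeMap m).app Y) h.symm).trans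
            (((functorOfCoconeMap m).naturality f).trans
              (congrArg ((functorOfCoconeMap m).app X ≫ ·) h')) }
    refine ⟨.ofNatTrans (Localization.Construction.natTransExtension τ),
      PseudoCocone.hom_ext fun x a => ?_⟩
    exact Localization.Construction.NatTransExtension.app_eq τ (of ⟨x, a⟩)

lemma toCoconeFunctor_naturality {E E' : Cat.{max u₁ u₂ v₁ v₂, max u₁ u₂}} (G : E ⟶ E') :
    toCoconeFunctor (F := F) E ⋙ postcomp F (constMap B G) =
      postcomp (localizedElements F) G ⋙ toCoconeFunctor E' :=
  CategoryTheory.Functor.ext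
    -- Both sides agree definitionally on the objects of the fibers, so that all the components of
    -- the `eqToHom` are identities.
    (fun K => PseudoCocone.ext (fun _ _ => rfl)
      (fun x a a' φ => by
        refine Eq.trans ?_ ((Category.id_comp _).trans (Category.comp_id _)).symm
        rfl)
      (fun {x y} f a => by
        refine Eq.trans ?_ ((Category.id_comp _).trans (Category.comp_id _)).symm
        exact PseudoCocone.iso_comp_constMap (toCocone K) G f a))
    (fun K K' t => PseudoCocone.hom_ext fun x a => by
      simp only [PseudoCocone.homApp_comp, PseudoCocone.homApp_eqToHom]
      exact ((Category.id_comp _).trans (Category.comp_id _)).symm)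

/-- The localization of `π₀` of the bicategory of elements strictly represents pseudo-cocones. -/
noncomputable def pseudocolimitRepresentation :
    PseudocolimitRepresentation F (localizedElements F) where
  functor := toCoconeFunctor
  inverse E := strictInverse (toCoconeFunctor E) ofCocone toCocone_ofCocone
  functor_comp_inverse E := comp_strictInverse _ _ ofCocone_toCocone _
  inverse_comp_functor E := strictInverse_comp _ _ _
  naturality := toCoconeFunctor_naturality
  naturality₂ {E E' G G'} τ := by
    refine NatTrans.ext <| funext fun K => PseudoCocone.hom_ext fun x a => ?_
    have h := PseudoCocone.homApp_eqToHom_app (toCoconeFunctor_naturality (F := F) G) K x a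
    have h' := PseudoCocone.homApp_eqToHom_app (toCoconeFunctor_naturality (F := F) G') K x a
    let t := (τ.toNatTrans.app (K.toFunctor.obj ((toLocalizedElements F).obj (of ⟨x, a⟩))))
    -- The components of the two `eqToHom` at objects of the fibers are identities.
    exact (congrArg (t ≫ ·) h').trans ((Category.comp_id t).trans
      ((Category.id_comp t).symm.trans (congrArg (· ≫ t) h.symm)))

end

end BicatColim

theorem mainTheorem2 {B : Type u₁} [Bicategory.{w, v₁} B]
    (F : B ⥤ᵖ Cat.{max u₁ u₂ v₁ v₂, max u₁ u₂}) :
    BicatColim.IsPseudocolimit F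
      (Cat.of (BicatColim.PiZero.classes
        (BicatColim.IsCoCartesian (BicatColim.Elements.proj F))).Localization) :=
  ⟨BicatColim.pseudocolimitRepresentation⟩
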